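/- Let $d\ge 3$. There is a constant $k_d>0$ depending only on $d$ such that the following holds for every $n\ge 1$ for which a $d$-regular simple graph on the vertex set $[n]$ exists. Let $G$ be drawn uniformly at random from the $d$-regular simple graphs on $[n]$. Let $\mathcal A$ be any (possibly randomized and adaptive) algorithm which at each step, depending on the steps and answers so far and on its own randomness, either halts, or makes a $\mathrm{rand\_neighbor}(v)$ probe for a vertex $v$ of its choice (answered by a fresh uniformly random neighbor of $v$ in $G$), or makes a $\mathrm{rand\_vertex}$ probe (answered by a fresh uniformly random vertex of $G$), or marks a vertex of its choice. Every vertex touched by a probe (the vertex probed and the vertex returned) is marked as well. Suppose that $\mathcal A$ makes at most $\sqrt n/k_d$ steps (probes and markings together). Then, with probability at least $0.995$ over $G$, the answers and the randomness of $\mathcal A$, both of the following hold: 1. the graph formed by the set of edges $\{v,w\}$ revealed by the $\mathrm{rand\_neighbor}$ probes ($w$ being returned for a probe at $v$) is a forest; 2. no $\mathrm{rand\_neighbor}$ probe ever merges two marked trees: whenever a probe at $v$ returns a vertex $w$ that was already marked before this probe, $v$ and $w$ already lie in the same connected component of the graph of the edges revealed before this probe. (The probed vertex $v$ counts as marked from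 the moment it is probed, so a vertex not marked before is a tree of its own; re-tracing a revealed edge is not a merge.) -/

import Mathlib

open scoped ENNReal

namespace RegProbe

/-- The `d`-regular simple graphs on the labelled vertex set `Fin n`. -/
noncomputable def regularGraphs (n d : ℕ) : Finset (SimpleGraph (Fin n)) :=
  open Classical in Finset.univ.filter fun G => G.IsRegularOfDegree d

/-- What an algorithm may ask for in one step: a random neighbor of `v`, a random vertex,
or that the vertex `v` be marked. -/
inductive Op (n : ℕ) : Type
  | randNeighbor (v : Fin n)
  | randVertex
  | mark (v : Fin n)

/-- One performed step, with its answer: `randNeighbor v w` means that a random neighbor of `v`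
was requested and `w` was returned; `randVertex w` means that the random vertex returned is `w`. -/
inductive Step (n : ℕ) : Type
  | randNeighbor (v w : Fin n)
  | randVertex (w : Fin n)
  | mark (v : Fin n)

/-- The list of steps performed so far, the most recent one first. -/
abbrev Transcript (n : ℕ) : Type := List (Step n)

/-- A randomized, adaptive algorithm: from the transcript so far it draws its next request
at random; `none` means that it halts (for good). It has no other access to the graph. -/
abbrev Algorithm (n : ℕ) : Type := Transcript n → PMF (Option (Op n))

/-- The random answer of the graph `G` to one request. -/
noncomputable def answer {n : ℕ} [NeZero n] (G : SimpleGraph (Fin n)) : Op n → PMF (Step n)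
  | .randNeighbor v =>
      open Classical in
      -- The second branch concerns isolated vertices only; these do not occur for degree `d ≥ 1`.
      if hv : (G.neighborFinset v).Nonempty then
        (PMF.uniformOfFinset (G.neighborFinset v) hv).map (Step.randNeighbor v)
      else PMF.pure (.mark v)
  | .randVertex => (PMF.uniformOfFintype (Fin n)).map Step.randVertex
  | .mark v => PMF.pure (.mark v)

/-- The law of the transcript when the algorithm `A` is run on the graph `G` for at most `q`
further steps (fewer if it halts), from the transcript `h` on. -/
noncomputable def runFrom {n : ℕ} [NeZero n] (A : Algorithm n) (G : SimpleGraph (Fin n)) :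
    ℕ → Transcript n → PMF (Transcript n)
  | 0, h => PMF.pure h
  | q + 1, h => (A h).bind fun o =>
      match o with
      | none => PMF.pure h
      | some a => (answer G a).bind fun s => runFrom A G q (s :: h)

/-- The law of the transcript of at most `q` steps of `A` on a uniformly random `d`-regular
graph on `n` vertices. -/
noncomputable def transcriptLaw (n d : ℕ) [NeZero n] (hne : (regularGraphs n d).Nonempty)
    (A : Algorithm n) (q : ℕ) : PMF (Transcript n) :=
  (PMF.uniformOfFinset (regularGraphs n d) hne).bind fun G => runFrom A G q []

/-- The vertices that a step touches, all of which become marked. -/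
def Step.touched {n : ℕ} : Step n → Set (Fin n)
  | .randNeighbor v w => {v, w}
  | .randVertex w => {w}
  | .mark v => {v}

/-- The vertices marked during a transcript. -/
def marked {n : ℕ} (h : Transcript n) : Set (Fin n) :=
  {x | ∃ s ∈ h, x ∈ s.touched}

/-- The graph whose edges are those revealed by the random-neighbor probes of a transcript. -/
def revealed {n : ℕ} (h : Transcript n) : SimpleGraph (Fin n) :=
  SimpleGraph.fromRel fun v w => Step.randNeighbor v w ∈ h

/-- A random-neighbor probe at `v` answered by `w`, made after the transcript `h`, merges two
marked trees. The trees are the connected components of the revealed graph that consist of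
marked vertices (possibly a single one). The probed vertex `v` is touched by the probe and so
counts as marked, whether or not it was marked before; the probe merges two trees if `w` was
marked already and lies in another component than `v`. -/
def Merges {n : ℕ} (h : Transcript n) (v w : Fin n) : Prop :=
  w ∈ marked h ∧ ¬ (revealed h).Reachable v w

/-- No random-neighbor probe of the transcript merged two marked trees when it was made. -/
def NeverMerges {n : ℕ} (h : Transcript n) : Prop :=
  ∀ (h₀ : Transcript n) (v w : Fin n), (Step.randNeighbor v w :: h₀) <:+ h → ¬ Merges h₀ v w

end RegProbe

/-! Given a transcript `h`, each graph containing the revealed edges is equally likely: every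
neighbor probe has likelihood `1/d` in any such graph, and the algorithm's choices depend on `h`
alone. So failure probabilities are summed over `extensions d h`, with no explicit conditioning. A
probe at `v` can do damage only by returning a marked `w` with `vw` unrevealed. Switching `vw`
against a distant unrevealed edge `xy` shows that `vw` lies in at most a `d²/m` fraction of the
extensions (`card_extensions_cons_mul_le`). At most `2q` vertices are marked, and each neighbor is
returned with probability `1/d`, so a step fails with probability at most `2qd/m`. Induction on the
remaining steps (`sum_runFrom_not_good_le`) gives `2q²d/m` in total, which is small for `m = n` and
`q` of order `√n/d`. -/

namespace RegProbe

variable {n : ℕ}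

/-! ### Revealed edges and marked vertices -/

theorem revealed_adj {h : Transcript n} {a b : Fin n} :
    (revealed h).Adj a b ↔ a ≠ b ∧ (Step.randNeighbor a b ∈ h ∨ Step.randNeighbor b a ∈ h) :=
  SimpleGraph.fromRel_adj ..

theorem revealed_nil : revealed ([] : Transcript n) = ⊥ := by
  ext a b
  simp [revealed_adj]

theorem revealed_cons_randVertex (h : Transcript n) (w : Fin n) :
    revealed (.randVertex w :: h) = revealed h := by
  ext a b
  simp [revealed_adj]

theorem revealed_cons_mark (h : Transcript n) (v : Fin n) :
    revealed (.mark v :: h) = revealed h := by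
  ext a b
  simp [revealed_adj]

theorem revealed_cons_randNeighbor (h : Transcript n) (v w : Fin n) :
    revealed (.randNeighbor v w :: h) = revealed h ⊔ SimpleGraph.edge v w := by
  ext a b
  simp only [revealed_adj, SimpleGraph.sup_adj, SimpleGraph.edge_adj, List.mem_cons,
    Step.randNeighbor.injEq]
  tauto

theorem marked_cons (s : Step n) (h : Transcript n) :
    marked (s :: h) = s.touched ∪ marked h := by
  ext x
  simp [marked]

theorem ncard_marked_le (h : Transcript n) : (marked h).ncard ≤ 2 * h.length := by
  induction h with
  | nil => simp [marked]
  | cons s h ih =>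
    rw [marked_cons, List.length_cons]
    have hs : s.touched.ncard ≤ 2 := by
      cases s with
      | randNeighbor v w => simpa [Step.touched] using Set.ncard_insert_le v {w}
      | randVertex w => simp [Step.touched]
      | mark v => simp [Step.touched]
    have := Set.ncard_union_le s.touched (marked h)
    omega

theorem mem_marked_of_adj {h : Transcript n} {a b : Fin n} (hab : (revealed h).Adj a b) :
    a ∈ marked h := by
  obtain ⟨-, hs | hs⟩ := revealed_adj.1 hab
  · exact ⟨_, hs, by simp [Step.touched]⟩
  · exact ⟨_, hs, by simp [Step.touched]⟩

/-! ### Good transcripts -/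

/-- The revealed edges form a forest, and no probe has merged two marked trees. -/
def Good (h : Transcript n) : Prop :=
  (revealed h).IsAcyclic ∧ NeverMerges h

theorem good_nil : Good ([] : Transcript n) := by
  refine ⟨by rw [revealed_nil]; exact SimpleGraph.isAcyclic_bot, fun h₀ v w hs => ?_⟩
  simp at hs

theorem Good.cons_randVertex {h : Transcript n} (hg : Good h) (w : Fin n) :
    Good (.randVertex w :: h) := by
  refine ⟨by rw [revealed_cons_randVertex]; exact hg.1, fun h₀ a b hs => ?_⟩
  rcases List.suffix_cons_iff.1 hs with hs | hs
  · simp at hs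
  · exact hg.2 h₀ a b hs

theorem Good.cons_mark {h : Transcript n} (hg : Good h) (v : Fin n) :
    Good (.mark v :: h) := by
  refine ⟨by rw [revealed_cons_mark]; exact hg.1, fun h₀ a b hs => ?_⟩
  rcases List.suffix_cons_iff.1 hs with hs | hs
  · simp at hs
  · exact hg.2 h₀ a b hs

/-- An unmarked `w` is isolated in the revealed graph, so the new edge hangs a leaf and closes no
cycle; a marked `w` is harmless when the edge is merely re-traced. -/
theorem Good.cons_randNeighbor {h : Transcript n} (hg : Good h) {v w : Fin n} (hvw : v ≠ w)
    (hw : w ∈ marked h → (revealed h).Adj v w) : Good (.randNeighbor v w :: h) := by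
  refine ⟨?_, fun h₀ a b hs => ?_⟩
  · rw [revealed_cons_randNeighbor]
    by_cases hwm : w ∈ marked h
    · rw [SimpleGraph.sup_edge_of_adj _ (hw hwm)]
      exact hg.1
    · refine (SimpleGraph.isAcyclic_add_edge_iff_of_not_reachable v w fun hr => hwm ?_).2 hg.1
      obtain ⟨p⟩ := hr.symm
      cases p with
      | nil => exact absurd rfl hvw
      | cons hadj _ => exact mem_marked_of_adj hadj
  · rcases List.suffix_cons_iff.1 hs with hs | hs
    · obtain ⟨⟨rfl, rfl⟩, rfl⟩ : (a = v ∧ b = w) ∧ h₀ = h := by simpa using hs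
      exact fun hm => hm.2 (hw hm.1).reachable
    · exact hg.2 h₀ a b hs

/-! ### Switchings -/

/-- Replace the edges `vw` and `xy` by `vx` and `wy`. -/
def switch (G : SimpleGraph (Fin n)) (v w x y : Fin n) : SimpleGraph (Fin n) :=
  G \ (SimpleGraph.edge v w ⊔ SimpleGraph.edge x y) ⊔
    (SimpleGraph.edge v x ⊔ SimpleGraph.edge w y)

theorem switch_adj {G : SimpleGraph (Fin n)} {v w x y a b : Fin n} :
    (switch G v w x y).Adj a b ↔
      (G.Adj a b ∧ s(a, b) ≠ s(v, w) ∧ s(a, b) ≠ s(x, y)) ∨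
        a ≠ b ∧ (s(a, b) = s(v, x) ∨ s(a, b) = s(w, y)) := by
  simp only [switch, SimpleGraph.sup_adj, SimpleGraph.sdiff_adj, SimpleGraph.edge_adj, ne_eq,
    Sym2.eq_iff]
  constructor
  · rintro (⟨h, h'⟩ | h)
    · have := h.ne
      tauto
    · tauto
  · tauto

/-- These symmetries reduce the degree count at the four switched vertices to the one at `v`. -/
theorem switch_comm₁ (G : SimpleGraph (Fin n)) (v w x y : Fin n) :
    switch G v w x y = switch G w v y x := by
  simp only [switch, SimpleGraph.edge_comm v w, SimpleGraph.edge_comm x y, sup_comm]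

theorem switch_comm₂ (G : SimpleGraph (Fin n)) (v w x y : Fin n) :
    switch G v w x y = switch G x y v w := by
  unfold switch
  rw [SimpleGraph.edge_comm v x, SimpleGraph.edge_comm w y,
    sup_comm (SimpleGraph.edge v w)]

/-- The pair `(x, y)` spans an edge of `G` which may be switched against the edge `vw`. -/
structure Switchable (G : SimpleGraph (Fin n)) (v w x y : Fin n) : Prop where
  adj : G.Adj v w
  adj' : G.Adj x y
  ne : x ≠ v
  ne' : y ≠ w
  not_adj : ¬ G.Adj v x
  not_adj' : ¬ G.Adj w y

theorem Switchable.symm₁ {G : SimpleGraph (Fin n)} {v w x y : Fin n}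
    (h : Switchable G v w x y) : Switchable G w v y x :=
  ⟨h.adj.symm, h.adj'.symm, h.ne', h.ne, h.not_adj', h.not_adj⟩

theorem Switchable.symm₂ {G : SimpleGraph (Fin n)} {v w x y : Fin n}
    (h : Switchable G v w x y) : Switchable G x y v w :=
  ⟨h.adj', h.adj, h.ne.symm, h.ne'.symm, fun h' => h.not_adj h'.symm,
    fun h' => h.not_adj' h'.symm⟩

open Classical in
theorem Switchable.degree_switch_left {G : SimpleGraph (Fin n)} {v w x y : Fin n}
    (h : Switchable G v w x y) : (switch G v w x y).degree v = G.degree v := by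
  have hvw := h.adj.ne
  -- The non-adjacency conditions also rule out `w = x` and `v = y`.
  have hwx : w ≠ x := fun e => h.not_adj (e ▸ h.adj)
  have hvy : v ≠ y := fun e => h.not_adj' (e ▸ h.adj.symm)
  have hN : (switch G v w x y).neighborFinset v = insert x ((G.neighborFinset v).erase w) := by
    ext b
    have := h.ne
    simp only [SimpleGraph.mem_neighborFinset, switch_adj, Finset.mem_insert, Finset.mem_erase,
      Sym2.eq_iff]
    grind
  rw [← SimpleGraph.card_neighborFinset_eq_degree, hN, Finset.card_insert_of_notMem,
    Finset.card_erase_add_one, SimpleGraph.card_neighborFinset_eq_degree]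
  · simpa using h.adj
  · simp [h.not_adj]

open Classical in
theorem Switchable.degree_switch {G : SimpleGraph (Fin n)} {v w x y : Fin n}
    (h : Switchable G v w x y) (u : Fin n) : (switch G v w x y).degree u = G.degree u := by
  by_cases hv : u = v
  · subst hv
    exact h.degree_switch_left
  by_cases hw : u = w
  · subst hw
    convert h.symm₁.degree_switch_left using 2
    exact switch_comm₁ ..
  by_cases hx : u = x
  · subst hx
    convert h.symm₂.degree_switch_left using 2
    exact switch_comm₂ ..
  by_cases hy : u = y
  · subst hy
    convert h.symm₂.symm₁.degree_switch_left using 2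
    exact (switch_comm₂ ..).trans (switch_comm₁ ..)
  rw [← SimpleGraph.card_neighborFinset_eq_degree, ← SimpleGraph.card_neighborFinset_eq_degree]
  congr 1
  ext b
  simp only [SimpleGraph.mem_neighborFinset, switch_adj, Sym2.eq_iff]
  grind

/-- Switchability prescribes adjacency on the four altered pairs, and a switching changes nothing
elsewhere, so it can be undone once `v, w, x, y` are known. -/
theorem Switchable.eq_of_switch_eq {G H : SimpleGraph (Fin n)} {v w x y : Fin n}
    (hG : Switchable G v w x y) (hH : Switchable H v w x y)
    (h : switch G v w x y = switch H v w x y) : G = H := by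
  ext a b
  have hab : (switch G v w x y).Adj a b ↔ (switch H v w x y).Adj a b := by rw [h]
  rw [switch_adj, switch_adj] at hab
  obtain ⟨g₁, g₂, g₃, g₄, g₅, g₆⟩ := hG
  obtain ⟨h₁, h₂, h₃, h₄, h₅, h₆⟩ := hH
  have key : ∀ {u z : Fin n}, s(a, b) = s(u, z) →
      ((G.Adj a b ↔ G.Adj u z) ∧ (H.Adj a b ↔ H.Adj u z)) := fun e =>
    ⟨G.adj_congr_of_sym2 e, H.adj_congr_of_sym2 e⟩
  by_cases e₁ : s(a, b) = s(v, w)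
  · simp [key e₁, g₁, h₁]
  by_cases e₂ : s(a, b) = s(x, y)
  · simp [key e₂, g₂, h₂]
  by_cases e₃ : s(a, b) = s(v, x)
  · simp [key e₃, g₅, h₅]
  by_cases e₄ : s(a, b) = s(w, y)
  · simp [key e₄, g₆, h₆]
  simpa [e₁, e₂, e₃, e₄] using hab

/-! ### Counting extensions by switching -/

/-- The `d`-regular graphs which contain all the edges revealed by a transcript. -/
noncomputable def extensions (d : ℕ) (h : Transcript n) : Finset (SimpleGraph (Fin n)) :=
  open Classical in (regularGraphs n d).filter fun G => revealed h ≤ G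

theorem mem_regularGraphs {d : ℕ} {G : SimpleGraph (Fin n)} [G.LocallyFinite] :
    G ∈ regularGraphs n d ↔ G.IsRegularOfDegree d := by
  classical
  simp only [regularGraphs, Finset.mem_filter, Finset.mem_univ, true_and]
  constructor <;> intro h v <;> rw [← h v] <;> congr!

theorem mem_extensions {d : ℕ} {h : Transcript n} {G : SimpleGraph (Fin n)} :
    G ∈ extensions d h ↔ G ∈ regularGraphs n d ∧ revealed h ≤ G := by
  simp [extensions]

theorem mem_extensions_cons_randNeighbor {d : ℕ} {h : Transcript n} {G : SimpleGraph (Fin n)}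
    {v w : Fin n} (hvw : v ≠ w) :
    G ∈ extensions d (.randNeighbor v w :: h) ↔ G ∈ extensions d h ∧ G.Adj v w := by
  rw [mem_extensions, mem_extensions, revealed_cons_randNeighbor, sup_le_iff,
    SimpleGraph.edge_le_iff]
  simp [hvw, and_assoc]

open Classical in
theorem card_revealed_pairs_le (h : Transcript n) :
    (Finset.univ.filter fun p : Fin n × Fin n => (revealed h).Adj p.1 p.2).card ≤
      2 * h.length := by
  induction h with
  | nil => simp [revealed_nil]
  | cons s h ih =>
    rw [List.length_cons]
    cases s with
    | randVertex w =>
      simp only [revealed_cons_randVertex]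
      omega
    | mark v =>
      simp only [revealed_cons_mark]
      omega
    | randNeighbor v w =>
      have hsub : (Finset.univ.filter fun p : Fin n × Fin n =>
          (revealed (.randNeighbor v w :: h)).Adj p.1 p.2) ⊆
          (Finset.univ.filter fun p : Fin n × Fin n => (revealed h).Adj p.1 p.2) ∪
            {(v, w), (w, v)} := by
        rintro ⟨a, b⟩ hab
        simp only [revealed_cons_randNeighbor, Finset.mem_filter, Finset.mem_univ, true_and,
          SimpleGraph.sup_adj, SimpleGraph.edge_adj] at hab
        simp only [Finset.mem_union, Finset.mem_filter, Finset.mem_univ, true_and,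
          Finset.mem_insert, Finset.mem_singleton, Prod.mk.injEq]
        tauto
      have h₁ := Finset.card_le_card hsub
      have h₂ := Finset.card_union_le
        (Finset.univ.filter fun p : Fin n × Fin n => (revealed h).Adj p.1 p.2)
        {(v, w), (w, v)}
      have h₃ := Finset.card_le_two (a := (v, w)) (b := (w, v))
      omega

open Classical in
theorem card_pairs_fst_mem {d : ℕ} {G : SimpleGraph (Fin n)} (hG : G.IsRegularOfDegree d)
    (S : Finset (Fin n)) :
    (Finset.univ.filter fun p : Fin n × Fin n => G.Adj p.1 p.2 ∧ p.1 ∈ S).card = S.card * d := by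
  have : (Finset.univ.filter fun p : Fin n × Fin n => G.Adj p.1 p.2 ∧ p.1 ∈ S) =
      (S.sigma fun a => G.neighborFinset a).map (Equiv.sigmaEquivProd _ _).toEmbedding := by
    ext ⟨a, b⟩
    simp [and_comm]
  rw [this, Finset.card_map, Finset.card_sigma]
  simp [hG.degree_eq]

-- Of the `n * d` ordered adjacent pairs `(x, y)`, at most `2 * h.length` are revealed, and at most
-- `(d + 1) * d` are lost to each of: `x` equal or adjacent to `v`, `y` equal or adjacent to `w`.
open Classical in
theorem card_switchable_ge {d : ℕ} {G : SimpleGraph (Fin n)} (hG : G.IsRegularOfDegree d)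
    (h : Transcript n) {v w : Fin n} (hvw : G.Adj v w) :
    n * d ≤ (Finset.univ.filter fun p : Fin n × Fin n =>
      Switchable G v w p.1 p.2 ∧ ¬ (revealed h).Adj p.1 p.2).card +
        2 * h.length + 2 * ((d + 1) * d) := by
  set T := Finset.univ.filter fun p : Fin n × Fin n =>
      Switchable G v w p.1 p.2 ∧ ¬ (revealed h).Adj p.1 p.2
  set R := Finset.univ.filter fun p : Fin n × Fin n => (revealed h).Adj p.1 p.2
  let near (u : Fin n) : Finset (Fin n) := insert u (G.neighborFinset u)
  have hnear (u : Fin n) : (near u).card = d + 1 := by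
    rw [Finset.card_insert_of_notMem (by simp), SimpleGraph.card_neighborFinset_eq_degree,
      hG.degree_eq]
  let X (u : Fin n) := Finset.univ.filter fun p : Fin n × Fin n => G.Adj p.1 p.2 ∧ p.1 ∈ near u
  have hX (u : Fin n) : (X u).card = (d + 1) * d := by
    rw [card_pairs_fst_mem hG, hnear]
  have hall := card_pairs_fst_mem hG Finset.univ
  rw [Finset.card_univ, Fintype.card_fin] at hall
  have hsub : (Finset.univ.filter fun p : Fin n × Fin n =>
      G.Adj p.1 p.2 ∧ p.1 ∈ (Finset.univ : Finset (Fin n))) ⊆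
      T ∪ R ∪ X v ∪ (X w).map (Equiv.prodComm _ _).toEmbedding := by
    rintro ⟨a, b⟩ hab
    simp only [Finset.mem_filter, Finset.mem_univ, true_and, and_true] at hab
    by_cases h₁ : (revealed h).Adj a b
    · simp [R, h₁]
    by_cases h₂ : a ∈ near v
    · simp [X, h₂, hab]
    by_cases h₃ : b ∈ near w
    · simp [X, h₃, hab.symm]
    simp only [near, Finset.mem_insert, SimpleGraph.mem_neighborFinset, not_or] at h₂ h₃
    have : (a, b) ∈ T := by
      simp only [T, Finset.mem_filter, Finset.mem_univ, true_and]
      exact ⟨⟨hvw, hab, h₂.1, h₃.1, h₂.2, h₃.2⟩, h₁⟩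
    simp [this]
  have hR : R.card ≤ 2 * h.length := card_revealed_pairs_le h
  have h₀ := Finset.card_le_card hsub
  have h₁ := Finset.card_union_le (T ∪ R ∪ X v) ((X w).map (Equiv.prodComm _ _).toEmbedding)
  have h₂ := Finset.card_union_le (T ∪ R) (X v)
  have h₃ := Finset.card_union_le T R
  rw [Finset.card_map, hX] at h₁
  rw [hX] at h₂
  omega

/-- By switching, an unrevealed edge is present in few of the extensions. -/
theorem card_extensions_cons_mul_le {d : ℕ} (h : Transcript n) {v w : Fin n} (hvw : v ≠ w)
    (hF : ¬ (revealed h).Adj v w) (m : ℕ)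
    (hm : m + 2 * h.length + 2 * ((d + 1) * d) ≤ n * d) :
    (extensions d (.randNeighbor v w :: h)).card * m ≤ (extensions d h).card * (d * d) := by
  classical
  -- Double counting: switching maps `S` injectively into `T`, since in the new graph `x` is a
  -- neighbor of `v` and `y` one of `w`.
  let S := (extensions d (.randNeighbor v w :: h)).sigma fun G =>
    Finset.univ.filter fun p : Fin n × Fin n =>
      Switchable G v w p.1 p.2 ∧ ¬ (revealed h).Adj p.1 p.2
  let T := (extensions d h).sigma fun G => G.neighborFinset v ×ˢ G.neighborFinset w
  have hS : (extensions d (.randNeighbor v w :: h)).card * m ≤ S.card := by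
    rw [Finset.card_sigma, ← smul_eq_mul]
    refine Finset.card_nsmul_le_sum _ _ _ fun G hG => ?_
    rw [mem_extensions_cons_randNeighbor hvw, mem_extensions, mem_regularGraphs] at hG
    have := card_switchable_ge hG.1.1 h hG.2
    omega
  have hT : T.card = (extensions d h).card * (d * d) := by
    rw [Finset.card_sigma, ← smul_eq_mul]
    refine Finset.sum_const_nat fun G hG => ?_
    rw [mem_extensions, mem_regularGraphs] at hG
    simp [hG.1.degree_eq]
  rw [← hT]
  refine hS.trans (Finset.card_le_card_of_injOn
    (fun t => ⟨switch t.1 v w t.2.1 t.2.2, t.2⟩) ?_ ?_)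
  · rintro ⟨G, x, y⟩ ht
    simp only [S, Finset.coe_sigma, Set.mem_sigma_iff, Finset.mem_coe, Finset.mem_filter,
      Finset.mem_univ, true_and, mem_extensions_cons_randNeighbor hvw, mem_extensions,
      mem_regularGraphs] at ht
    obtain ⟨⟨⟨hreg, hle⟩, -⟩, hsw, hxy⟩ := ht
    simp only [T, Finset.coe_sigma, Set.mem_sigma_iff, Finset.mem_coe, Finset.mem_product,
      SimpleGraph.mem_neighborFinset, mem_extensions, mem_regularGraphs, switch_adj]
    refine ⟨⟨fun u => (hsw.degree_switch u).trans (hreg u), fun a b hab => ?_⟩, ?_, ?_⟩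
    -- Both removed edges are unrevealed, so every revealed edge survives.
    · refine switch_adj.2 (Or.inl ⟨hle hab, fun e => hF ?_, fun e => hxy ?_⟩)
      · exact ((revealed h).adj_congr_of_sym2 e).1 hab
      · exact ((revealed h).adj_congr_of_sym2 e).1 hab
    · exact Or.inr ⟨hsw.ne.symm, Or.inl trivial⟩
    · exact Or.inr ⟨hsw.ne'.symm, Or.inr trivial⟩
  · rintro ⟨G, p⟩ hG ⟨H, p'⟩ hH e
    simp only [S, Finset.coe_sigma, Set.mem_sigma_iff, Finset.mem_coe, Finset.mem_filter,
      Finset.mem_univ, true_and] at hG hH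
    simp only [Sigma.mk.injEq, heq_eq_eq] at e
    obtain ⟨e, rfl⟩ := e
    rw [hG.2.1.eq_of_switch_eq hH.2.1 e]

/-! ### Failure probability averaged over extensions -/

theorem toOuterMeasure_le_one {α : Type*} (p : PMF α) (s : Set α) : p.toOuterMeasure s ≤ 1 :=
  (p.toOuterMeasure.mono (Set.subset_univ s)).trans
    ((p.toOuterMeasure_apply_eq_one_iff _).2 (Set.subset_univ _)).le

section Answer

variable [NeZero n] {β : Type*} (f : Step n → PMF β) (s : Set β) (G : SimpleGraph (Fin n))

open Classical in
theorem toOuterMeasure_answer_randNeighbor_bind {d : ℕ} (hd : 0 < d)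
    (hG : G.IsRegularOfDegree d) (v : Fin n) :
    ((answer G (.randNeighbor v)).bind f).toOuterMeasure s =
      (d : ℝ≥0∞)⁻¹ * ∑ w ∈ G.neighborFinset v, (f (.randNeighbor v w)).toOuterMeasure s := by
  have hcard : (G.neighborFinset v).card = d := hG v
  have hne : (G.neighborFinset v).Nonempty := Finset.card_pos.1 (hcard ▸ hd)
  rw [answer, dif_pos hne, PMF.bind_map, PMF.toOuterMeasure_bind_apply, tsum_fintype,
    Finset.mul_sum, ← Finset.sum_subset (Finset.subset_univ (G.neighborFinset v))]
  · refine Finset.sum_congr rfl fun w hw => ?_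
    rw [PMF.uniformOfFinset_apply_of_mem hne hw, hcard]
    rfl
  · intro w _ hw
    rw [PMF.uniformOfFinset_apply_of_notMem hne hw, zero_mul]

theorem toOuterMeasure_answer_randVertex_bind :
    ((answer G .randVertex).bind f).toOuterMeasure s =
      (n : ℝ≥0∞)⁻¹ * ∑ w, (f (.randVertex w)).toOuterMeasure s := by
  rw [answer, PMF.bind_map, PMF.toOuterMeasure_bind_apply, tsum_fintype, Finset.mul_sum]
  simp

theorem toOuterMeasure_answer_mark_bind (v : Fin n) :
    ((answer G (.mark v)).bind f).toOuterMeasure s = (f (.mark v)).toOuterMeasure s := by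
  rw [answer, PMF.pure_bind]

end Answer

theorem extensions_cons_randVertex (d : ℕ) (h : Transcript n) (w : Fin n) :
    extensions d (.randVertex w :: h) = extensions d h := by
  rw [extensions, extensions, revealed_cons_randVertex]

theorem extensions_cons_mark (d : ℕ) (h : Transcript n) (v : Fin n) :
    extensions d (.mark v :: h) = extensions d h := by
  rw [extensions, extensions, revealed_cons_mark]

-- This exchange plays the role of conditioning on the answer `w`: the extensions of `h` containing
-- `vw` are those of the longer transcript.
open Classical in
theorem sum_extensions_sum_neighborFinset {M : Type*} [AddCommMonoid M] (d : ℕ)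
    (h : Transcript n) (v : Fin n) (Y : SimpleGraph (Fin n) → Fin n → M) :
    ∑ G ∈ extensions d h, ∑ w ∈ G.neighborFinset v, Y G w =
      ∑ w ∈ Finset.univ.erase v, ∑ G ∈ extensions d (.randNeighbor v w :: h), Y G w := by
  refine Finset.sum_comm' fun G w => ?_
  by_cases hvw : v = w
  · subst hvw
    simp
  · rw [mem_extensions_cons_randNeighbor hvw]
    simp [Ne.symm hvw]

theorem sum_card_extensions_cons (d : ℕ) (h : Transcript n) (v : Fin n) :
    ∑ w ∈ Finset.univ.erase v, (extensions d (.randNeighbor v w :: h)).card =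
      (extensions d h).card * d := by
  classical
  have := sum_extensions_sum_neighborFinset d h v fun _ _ => 1
  simp only [Finset.sum_const, smul_eq_mul, mul_one] at this
  rw [← this]
  refine Finset.sum_const_nat fun G hG => ?_
  rw [mem_extensions, mem_regularGraphs] at hG
  exact hG.1 v

/-- If every unrevealed edge lies in at most a `p`-fraction of the extensions, then on average
over the extensions a run of `q` more steps fails with probability at most
`q * (2 * Q * p / d)`, where `Q` bounds the length of the transcript. -/
theorem sum_runFrom_not_good_le [NeZero n] {d : ℕ} (hd : 0 < d) (A : Algorithm n) (Q : ℕ)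
    (p : ℝ≥0∞)
    (hp : ∀ h : Transcript n, h.length ≤ Q → ∀ v w, v ≠ w → ¬ (revealed h).Adj v w →
      ((extensions d (.randNeighbor v w :: h)).card : ℝ≥0∞) ≤ p * (extensions d h).card)
    (q : ℕ) (h : Transcript n) (hq : h.length + q ≤ Q) (hg : Good h) :
    ∑ G ∈ extensions d h, (runFrom A G q h).toOuterMeasure {t | ¬ Good t} ≤
      q * ((d : ℝ≥0∞)⁻¹ * (2 * Q * p)) * (extensions d h).card := by
  classical
  have hd0 : (d : ℝ≥0∞) ≠ 0 := by exact_mod_cast hd.ne'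
  have hdt : (d : ℝ≥0∞) ≠ ∞ := ENNReal.natCast_ne_top d
  induction q generalizing h with
  | zero => simp [runFrom, hg]
  | succ q ih =>
    set δ := (d : ℝ≥0∞)⁻¹ * (2 * Q * p) with hδ
    simp only [runFrom, PMF.toOuterMeasure_bind_apply]
    rw [← Summable.tsum_finsetSum fun _ _ => ENNReal.summable]
    simp only [← Finset.mul_sum]
    set B := ((q + 1 : ℕ) : ℝ≥0∞) * δ * (extensions d h).card with hB
    have hqB : q * δ * (extensions d h).card ≤ B := by
      rw [hB]
      gcongr
      omega
    -- The law `A h` of the request does not depend on `G`, so a bound for each fixed request is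
    -- enough.
    suffices H : ∀ o : Option (Op n), ∑ G ∈ extensions d h,
        (match o with
          | none => PMF.pure h
          | some a => (answer G a).bind fun s => runFrom A G q (s :: h)).toOuterMeasure
            {t | ¬ Good t} ≤ B by
      calc _ ≤ ∑' o, A h o * B := ENNReal.tsum_le_tsum fun o => mul_le_mul_right (H o) _
        _ = B := by rw [ENNReal.tsum_mul_right, PMF.tsum_coe, one_mul]
    rintro (_ | v | _ | v)
    · simp [hg]
    · have hreg : ∀ G ∈ extensions d h, G.IsRegularOfDegree d := fun G hG =>
        mem_regularGraphs.1 (mem_extensions.1 hG).1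
      dsimp only
      rw [Finset.sum_congr rfl fun G hG =>
        toOuterMeasure_answer_randNeighbor_bind _ _ G hd (hreg G hG) v, ← Finset.mul_sum,
        sum_extensions_sum_neighborFinset]
      have hw : ∀ w ∈ Finset.univ.erase v, ∑ G ∈ extensions d (.randNeighbor v w :: h),
          (runFrom A G q (.randNeighbor v w :: h)).toOuterMeasure {t | ¬ Good t} ≤
            q * δ * (extensions d (.randNeighbor v w :: h)).card +
              if w ∈ marked h then p * (extensions d h).card else 0 := by
        intro w hw
        have hvw : v ≠ w := (Finset.ne_of_mem_erase hw).symm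
        -- Harmless answers go to the induction hypothesis; for the others failure is bounded by 1
        -- and `hp` bounds the number of graphs.
        by_cases hgood : w ∈ marked h → (revealed h).Adj v w
        · exact (ih _ (by simp only [List.length_cons]; omega)
            (hg.cons_randNeighbor hvw hgood)).trans le_self_add
        · rw [Classical.not_imp] at hgood
          rw [if_pos hgood.1]
          calc _ ≤ ∑ G ∈ extensions d (.randNeighbor v w :: h), (1 : ℝ≥0∞) :=
                Finset.sum_le_sum fun G _ => toOuterMeasure_le_one _ _
            _ = (extensions d (.randNeighbor v w :: h)).card := by simp
            _ ≤ p * (extensions d h).card := hp h (by omega) v w hvw hgood.2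
            _ ≤ _ := le_add_self
      have hcard : (Finset.univ.filter fun w => w ∈ marked h).card ≤ 2 * Q := by
        have := ncard_marked_le h
        rw [Set.ncard_eq_toFinset_card'] at this
        have e : (marked h).toFinset = Finset.univ.filter fun w => w ∈ marked h := by
          ext w
          simp
        rw [e] at this
        omega
      calc _ ≤ (d : ℝ≥0∞)⁻¹ * ∑ w ∈ Finset.univ.erase v,
            (q * δ * (extensions d (.randNeighbor v w :: h)).card +
              if w ∈ marked h then p * (extensions d h).card else 0) :=
            mul_le_mul_right (Finset.sum_le_sum hw) _
        _ ≤ (d : ℝ≥0∞)⁻¹ * (q * δ * ((extensions d h).card * d) +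
              2 * Q * (p * (extensions d h).card)) := by
            gcongr
            rw [Finset.sum_add_distrib, ← Finset.mul_sum]
            gcongr
            · exact_mod_cast (sum_card_extensions_cons d h v).le
            · calc _ ≤ ∑ w, if w ∈ marked h then p * (extensions d h).card else 0 :=
                    Finset.sum_le_sum_of_subset (Finset.subset_univ _)
                _ = (Finset.univ.filter fun w => w ∈ marked h).card *
                      (p * (extensions d h).card) := by
                    rw [← Finset.sum_filter, Finset.sum_const, nsmul_eq_mul]
                _ ≤ _ := by
                    gcongr
                    exact_mod_cast hcard
        _ = ((d : ℝ≥0∞)⁻¹ * d) * (q * δ * (extensions d h).card) +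
              δ * (extensions d h).card := by
            rw [hδ]
            ring
        _ = B := by
            rw [ENNReal.inv_mul_cancel hd0 hdt, hB]
            push_cast
            ring
    · dsimp only
      simp only [toOuterMeasure_answer_randVertex_bind]
      rw [← Finset.mul_sum, Finset.sum_comm]
      have hn0 : (n : ℝ≥0∞) ≠ 0 := by exact_mod_cast NeZero.ne n
      calc _ ≤ (n : ℝ≥0∞)⁻¹ * ∑ w : Fin n, B := by
            gcongr with w
            have := ih (.randVertex w :: h) (by simp only [List.length_cons]; omega)
              (hg.cons_randVertex w)
            rw [extensions_cons_randVertex] at this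
            exact this.trans hqB
        _ = B := by
            rw [Finset.sum_const, Finset.card_univ, Fintype.card_fin, nsmul_eq_mul, ← mul_assoc,
              ENNReal.inv_mul_cancel hn0 (ENNReal.natCast_ne_top n), one_mul]
    · dsimp only
      simp only [toOuterMeasure_answer_mark_bind]
      have := ih (.mark v :: h) (by simp only [List.length_cons]; omega) (hg.cons_mark v)
      rw [extensions_cons_mark] at this
      exact this.trans hqB

/-! ### The bound for the full run and the choice of constants -/

theorem extensions_nil (d : ℕ) : extensions d ([] : Transcript n) = regularGraphs n d := by
  ext G
  simp [mem_extensions, revealed_nil]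

theorem toOuterMeasure_transcriptLaw_not_good_le [NeZero n] {d : ℕ} (hd : 0 < d)
    (hne : (regularGraphs n d).Nonempty) (A : Algorithm n) (q m : ℕ) (hm0 : m ≠ 0)
    (hm : m + 2 * q + 2 * ((d + 1) * d) ≤ n * d) :
    (transcriptLaw n d hne A q).toOuterMeasure {t | ¬ Good t} ≤ 2 * q ^ 2 * d / m := by
  classical
  have hd0 : (d : ℝ≥0∞) ≠ 0 := by exact_mod_cast hd.ne'
  have hdt : (d : ℝ≥0∞) ≠ ∞ := ENNReal.natCast_ne_top d
  have hm0' : (m : ℝ≥0∞) ≠ 0 := by exact_mod_cast hm0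
  have hc0 : ((regularGraphs n d).card : ℝ≥0∞) ≠ 0 := by exact_mod_cast hne.card_pos.ne'
  have key := sum_runFrom_not_good_le hd A q (d * d / m) (fun h hh v w hvw hF => by
    have := card_extensions_cons_mul_le (d := d) h hvw hF m (by omega)
    rw [ENNReal.mul_comm_div, ← mul_div_assoc, ENNReal.le_div_iff_mul_le (.inl hm0')
      (.inl (ENNReal.natCast_ne_top m))]
    calc _ ≤ ((extensions d h).card : ℝ≥0∞) * (d * d) := by exact_mod_cast this
      _ = _ := by ring) q [] (by simp) good_nil
  rw [extensions_nil] at key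
  rw [transcriptLaw, PMF.toOuterMeasure_bind_apply, tsum_fintype,
    ← Finset.sum_subset (Finset.subset_univ (regularGraphs n d))]
  · calc _ = ((regularGraphs n d).card : ℝ≥0∞)⁻¹ *
          ∑ G ∈ regularGraphs n d, (runFrom A G q []).toOuterMeasure {t | ¬ Good t} := by
          rw [Finset.mul_sum]
          exact Finset.sum_congr rfl fun G hG => by
            rw [PMF.uniformOfFinset_apply_of_mem hne hG]
      _ ≤ _ := mul_le_mul_right key _
      _ = ((regularGraphs n d).card : ℝ≥0∞)⁻¹ * (regularGraphs n d).card *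
            ((d : ℝ≥0∞)⁻¹ * d) * (2 * q ^ 2 * d / m) := by
          simp only [div_eq_mul_inv]
          ring
      _ = _ := by
          rw [ENNReal.inv_mul_cancel hc0 (ENNReal.natCast_ne_top _),
            ENNReal.inv_mul_cancel hd0 hdt, one_mul, one_mul]
  · intro G _ hG
    rw [PMF.uniformOfFinset_apply_of_notMem hne hG, zero_mul]

/-- Treated apart because without a step nothing forces `n` to be large, as the switching bound
requires. -/
theorem toOuterMeasure_transcriptLaw_zero_not_good [NeZero n] {d : ℕ}
    (hne : (regularGraphs n d).Nonempty) (A : Algorithm n) :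
    (transcriptLaw n d hne A 0).toOuterMeasure {t | ¬ Good t} = 0 := by
  simp [transcriptLaw, runFrom, good_nil]

end RegProbe

theorem lemma4p6 (d : ℕ) (hd : 3 ≤ d) :
    ∃ k : ℝ, 0 < k ∧
      ∀ (n : ℕ) [NeZero n] (hne : (RegProbe.regularGraphs n d).Nonempty)
        (A : RegProbe.Algorithm n) (q : ℕ), (q : ℝ) ≤ Real.sqrt n / k →
        (995 / 1000 : ℝ≥0∞) ≤ (RegProbe.transcriptLaw n d hne A q).toOuterMeasure
          {h | (RegProbe.revealed h).IsAcyclic ∧ RegProbe.NeverMerges h} := by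
  -- Squaring gives `400 * q² * (d + 1)² ≤ n`, hence `2q²d/n ≤ 2/400 = 5/1000`.
  refine ⟨20 * (d + 1), by positivity, fun n _ hne A q hq => ?_⟩
  have hqn : q ^ 2 * (400 * (d + 1) ^ 2) ≤ n := by
    rw [le_div_iff₀ (by positivity), Real.le_sqrt (by positivity) (by positivity)] at hq
    have : ((q ^ 2 * (400 * (d + 1) ^ 2) : ℕ) : ℝ) ≤ n := by
      push_cast
      linarith
    exact_mod_cast this
  have hbad : (RegProbe.transcriptLaw n d hne A q).toOuterMeasure {t | ¬ RegProbe.Good t} ≤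
      5 / 1000 := by
    rcases Nat.eq_zero_or_pos q with rfl | hq0
    · rw [RegProbe.toOuterMeasure_transcriptLaw_zero_not_good]
      exact zero_le
    have hn0 : (n : ℝ≥0∞) ≠ 0 := by exact_mod_cast NeZero.ne n
    have hqq : q ≤ q ^ 2 := Nat.le_self_pow two_ne_zero q
    -- With `m = n`, `d ≥ 3` leaves room `2n` for the lower-order terms, and `q ≥ 1` makes `n` at
    -- least `400 * (d + 1)²`.
    refine (RegProbe.toOuterMeasure_transcriptLaw_not_good_le (by omega) hne A q n
      (NeZero.ne n) ?_).trans ?_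
    · nlinarith [Nat.mul_le_mul_left n hd, Nat.mul_le_mul hq0 (le_refl (d ^ 2)),
        Nat.mul_le_mul_left (q ^ 2) (Nat.one_le_pow 2 (d + 1) (by omega)),
        Nat.mul_le_mul_right ((d + 1) ^ 2) (Nat.one_le_pow 2 q hq0)]
    · rw [ENNReal.div_le_iff hn0 (ENNReal.natCast_ne_top n), ENNReal.mul_comm_div,
        ← mul_div_assoc, ENNReal.le_div_iff_mul_le (by simp) (by simp)]
      have : 2 * q ^ 2 * d * 1000 ≤ 5 * n := by
        nlinarith [Nat.mul_le_mul_left (q ^ 2) (show d ≤ (d + 1) ^ 2 by nlinarith)]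
      exact_mod_cast this
  set μ := (RegProbe.transcriptLaw n d hne A q).toOuterMeasure
  have huniv : (1 : ℝ≥0∞) ≤ μ {t | RegProbe.Good t} + μ {t | ¬ RegProbe.Good t} := by
    refine le_trans (le_of_eq ?_) (MeasureTheory.measure_union_le _ _)
    symm
    rw [PMF.toOuterMeasure_apply_eq_one_iff]
    exact fun t _ => em _
  have h₁ : (995 / 1000 : ℝ≥0∞) + 5 / 1000 = 1 := by
    rw [← ENNReal.add_div, show (995 : ℝ≥0∞) + 5 = 1000 by norm_num]
    exact ENNReal.div_self (by simp) (by simp)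
  have h₂ : (995 / 1000 : ℝ≥0∞) + 5 / 1000 ≤ μ {t | RegProbe.Good t} + 5 / 1000 :=
    h₁.le.trans (huniv.trans (by gcongr))
  exact (ENNReal.add_le_add_iff_right (by finiteness)).1 h₂
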